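/- **Soundness of endpoint projection for Core Choreographies.** *Setting.* Fix types of process names, variables, values, expressions, Boolean expressions, annotations and procedure names, with evaluation functions for (Boolean) expressions in a local store. A state $s$ assigns a store to each process. Choreographies are $$C ::= p\#e\to q\$x\,@a;C \;\mid\; p\to q[l]\,@a;C \;\mid\; \mathsf{If}\ p??b\ \mathsf{Then}\ C_1\ \mathsf{Else}\ C_2 \;\mid\; \mathsf{Call}\,X \;\mid\; \mathsf{RT\_Call}\,X\,ps\,C \;\mid\; \mathsf{End},$$ with $l\in\{\mathsf{left},\mathsf{right}\}$. A CC program $P=(D,C)$ consists of procedure definitions $D$, where $D(X)$ is a list of processes $\mathrm{Vars}(X)$ together with a body, and a main choreography $C$. Labels are $p\to q$ with a value, $p\to q[l]$, and $\tau_p$. The labelled transitions $(P,s)\xrightarrow{t}(P',s')$ execute the first action, or (out of order) a later action that involves none of the processes of the constructs before it; under a conditional this requires the same transition, with the same label and resulting state, in both branches. Processes join a procedure call one at a time with label $\tau_p$: the runtime term $\mathsf{RT\_Call}\,X\,ps\,C$ records the processes $ps$ that have not yet joined the call, whose body has evolved to $C$. *Target.* Behaviours are $$B ::= \mathsf{End}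 \mid p!e\,@a;B \mid p?x\,@a;B \mid p\oplus l\,@a;B \mid p\,\&\,mB_1/\!/mB_2 \mid \mathsf{If}\ b\ \mathsf{Then}\ B_1\ \mathsf{Else}\ B_2 \mid \mathsf{Call}\,Y,$$ where each of $mB_1,mB_2$ (offered for $\mathsf{left}$, $\mathsf{right}$) is absent or an annotated behaviour. A network maps processes to behaviours; an SP program $N=(D',\mathrm{Net}\,N)$ pairs procedure definitions with a network. Its transitions synchronise matching actions of two processes, or execute a conditional or a procedure call locally, with the same labels as above. The branching order $B\sqsupseteq B'$ is the least relation closed under all constructors such that moreover $B$ may offer branches absent from $B'$ in branching terms; on networks it is taken pointwise. Merge is the partial binary operation on behaviours that combines corresponding subterms of equal shape and takes the union of the offers in branching terms. *Projection.* The projection of $C$ for a process $p$ is partial: an interaction is projected to the action of $p$ in it, and is skipped if $p$ is not involved; a conditional at $p$ is projected to a conditional; a conditional at another process is projected to the merge of the projections of its branches; $\mathsf{Call}\,X$ is projected to $\mathsf{Call}\,(X,p)$ if $p\in\mathrm{Vars}(X)$ and to $\mathsf{End}$ otherwise; $\mathsf{RT\_Call}\,X\,ps\,C$ is projected to $\mathsf{Call}\,(X,p)$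 if $p\in ps$ and to the projection of $C$ otherwise. $P$ is projectable if its main choreography can be projected for all processes occurring in $P$, and each procedure body can be projected for all processes in $\mathrm{Vars}(X)$; then $\mathrm{epp}\,P$ is the SP program consisting of these projections ($\mathsf{End}$ for all other processes). *Well-formedness.* $P$ is well-formed if its main choreography has no self-communications, and all its subterms $\mathsf{RT\_Call}\,X\,ps\,C$ have $\emptyset\ne ps\subseteq\mathrm{Vars}(X)$; and every procedure body has no self-communications, has no runtime terms, and uses only processes in $\mathrm{Vars}(X)\neq\emptyset$. *Strong projectability.* $P=(D,C)$ is strongly projectable if it is well-formed, each procedure body is projectable for all processes in $\mathrm{Vars}(X)$, and in $C$ (i) every conditional subterm is projectable for every process, and (ii) for every subterm $\mathsf{RT\_Call}\,X\,ps\,C'$ and every $p\in ps$, if $B$ and $B'$ are the projections for $p$ of the body of $X$ and of $C'$ respectively, then $B\sqsupseteq B'$. **Theorem.** Let $P$ be a strongly projectable (in particular well-formed and projectable) CC program, $s,s'$ states, and $N'$ an SP program. 1. If $(\mathrm{epp}\,P,s)\xrightarrow{t}(N',s')$, then there is a CC program $P'$ with $(P,s)\xrightarrow{t}(P',s')$ such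 that $P'$ is projectable and $\mathrm{Net}\,N'\sqsupseteq\mathrm{Net}(\mathrm{epp}\,P')$ pointwise. 2. The same holds for multi-step transitions: if $(\mathrm{epp}\,P,s)\xrightarrow{t_1}\cdots\xrightarrow{t_n}(N',s')$ with $n\ge 0$, then there is a CC program $P'$ with $(P,s)\xrightarrow{t_1}\cdots\xrightarrow{t_n}(P',s')$ such that $P'$ is projectable and $\mathrm{Net}\,N'\sqsupseteq\mathrm{Net}(\mathrm{epp}\,P')$ pointwise. -/

import Mathlib

universe u v

namespace CoreChor

/-! ### Signatures, states, labels -/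

/-- The data over which both calculi are parameterised: process names, local variables, values,
expressions, Boolean expressions, annotations, and the two evaluation functions, which take the
local store of the evaluating process.  The last component of a signature, the type `R` of
procedure names, is kept as a separate parameter, because it is the only one on which a choreography
(`R`) and its projection (`R × Pid`) differ.  (Since functions are extensional, evaluation
automatically respects pointwise equality of stores.) -/
structure Signature where
  Pid : Type u
  Var : Type u
  Val : Type u
  Expr : Type u
  BExpr : Type u
  Ann : Type u
  decPid : DecidableEq Pid
  decVar : DecidableEq Var
  eval : Expr → (Var → Val) → Val
  beval : BExpr → (Var → Val) → Bool

attribute [instance] Signature.decPid Signature.decVar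

/-- The memory state of all processes. -/
abbrev State (S : Signature.{u}) : Type u := S.Pid → S.Var → S.Val

/-- `s[[p, x => v]]`. -/
def State.update {S : Signature.{u}} (s : State S) (p : S.Pid) (x : S.Var) (v : S.Val) : State S :=
  fun q y => if q = p ∧ y = x then v else s q y

/-- Selection labels. -/
inductive Label : Type
  | left
  | right

/-- Labels of the lower layer of both semantics. -/
inductive RichLabel (S : Signature.{u}) (R : Type v) : Type (max u v)
  | com (p : S.Pid) (v : S.Val) (q : S.Pid) (x : S.Var)
  | sel (p q : S.Pid) (l : Label)
  | cond (p : S.Pid)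
  | call (X : R) (p : S.Pid)

/-- Observable labels. -/
inductive TransitionLabel (S : Signature.{u}) : Type u
  | com (p : S.Pid) (v : S.Val) (q : S.Pid)
  | sel (p q : S.Pid) (l : Label)
  | tau (p : S.Pid)

def RichLabel.forget {S : Signature.{u}} {R : Type v} : RichLabel S R → TransitionLabel S
  | .com p v q _ => .com p v q
  | .sel p q l => .sel p q l
  | .cond p => .tau p
  | .call _ p => .tau p

/-- The process `p` does not take part in an action with the given label. -/
def RichLabel.DisjointP {S : Signature.{u}} {R : Type v} (p : S.Pid) : RichLabel S R → Prop
  | .com q _ r _ => p ≠ q ∧ p ≠ r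
  | .sel q r _ => p ≠ q ∧ p ≠ r
  | .cond q => p ≠ q
  | .call _ q => p ≠ q

/-- No process in the list takes part in an action with the given label. -/
def RichLabel.DisjointPs {S : Signature.{u}} {R : Type v} (ps : List S.Pid) (t : RichLabel S R) :
    Prop :=
  ∀ p ∈ ps, t.DisjointP p

/-! ### The choreography language CC -/

namespace CC

/-- Interactions: value communication `p#e --> q$x` and label selection `p --> q[l]`. -/
inductive Eta (S : Signature.{u}) : Type u
  | com (p : S.Pid) (e : S.Expr) (q : S.Pid) (x : S.Var)
  | sel (p q : S.Pid) (l : Label)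

/-- The two processes of an interaction. -/
def Eta.pn {S : Signature.{u}} : Eta S → List S.Pid
  | .com p _ q _ => [p, q]
  | .sel p q _ => [p, q]

/-- Choreographies.  `rtCall X ps C` is the runtime term: procedure `X` has been expanded and has
evolved to `C`, and the processes in `ps` still have to join it. -/
inductive Choreography (S : Signature.{u}) (R : Type v) : Type (max u v)
  | interaction (eta : Eta S) (a : S.Ann) (C : Choreography S R)
  | cond (p : S.Pid) (b : S.BExpr) (C₁ C₂ : Choreography S R)
  | call (X : R)
  | rtCall (X : R) (ps : List S.Pid) (C : Choreography S R)
  | nil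

/-- Procedure definitions: the list of processes used by a procedure, and its body. -/
abbrev DefSet (S : Signature.{u}) (R : Type v) : Type (max u v) :=
  R → List S.Pid × Choreography S R

structure Program (S : Signature.{u}) (R : Type v) : Type (max u v) where
  procedures : DefSet S R
  main : Choreography S R

variable {S : Signature.{u}} {R : Type v}

/-- `Vars P X`. -/
def Program.vars (P : Program S R) (X : R) : List S.Pid := (P.procedures X).1

/-- `Procs P X`. -/
def Program.procs (P : Program S R) (X : R) : Choreography S R := (P.procedures X).2

/-- No runtime terms. -/
def Initial : Choreography S R → Prop
  | .interaction _ _ C => Initial C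
  | .cond _ _ C₁ C₂ => Initial C₁ ∧ Initial C₂
  | .call _ => True
  | .rtCall _ _ _ => False
  | .nil => True

def Eta.NoSelfComm : Eta S → Prop
  | .com p _ q _ => p ≠ q
  | .sel p q _ => p ≠ q

/-- No self-communications. -/
def NoSelfComm : Choreography S R → Prop
  | .interaction eta _ C => eta.NoSelfComm ∧ NoSelfComm C
  | .cond _ _ C₁ C₂ => NoSelfComm C₁ ∧ NoSelfComm C₂
  | .call _ => True
  | .rtCall _ _ C => NoSelfComm C
  | .nil => True

/-- All runtime terms carry a nonempty list of processes. -/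
def NoEmptyAnn : Choreography S R → Prop
  | .interaction _ _ C => NoEmptyAnn C
  | .cond _ _ C₁ C₂ => NoEmptyAnn C₁ ∧ NoEmptyAnn C₂
  | .call _ => True
  | .rtCall _ ps C => ps ≠ [] ∧ NoEmptyAnn C
  | .nil => True

def ChoreographyWF (C : Choreography S R) : Prop := NoSelfComm C ∧ NoEmptyAnn C

/-- The list of each runtime term `rtCall X ps C` only has processes from `vars X`. -/
def Consistent (vars : R → List S.Pid) : Choreography S R → Prop
  | .interaction _ _ C => Consistent vars C
  | .cond _ _ C₁ C₂ => Consistent vars C₁ ∧ Consistent vars C₂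
  | .call _ => True
  | .rtCall X ps C => ps ⊆ vars X ∧ Consistent vars C
  | .nil => True

/-- The processes occurring in a choreography, given those used by each procedure (as a list that
is only used as a set: its order and multiplicities are irrelevant). -/
def pn (vars : R → List S.Pid) : Choreography S R → List S.Pid
  | .interaction eta _ C => eta.pn ++ pn vars C
  | .cond p _ C₁ C₂ => p :: (pn vars C₁ ++ pn vars C₂)
  | .call X => vars X
  | .rtCall _ ps C => ps ++ pn vars C
  | .nil => []

/-- The processes occurring in a program. -/
def Program.pn (P : Program S R) : List S.Pid := CC.pn P.vars P.main

def WellAnn (P : Program S R) (X : R) : Prop :=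
  P.vars X ≠ [] ∧ CC.pn P.vars (P.procs X) ⊆ P.vars X

def ProgramWF (P : Program S R) : Prop :=
  ChoreographyWF P.main ∧ Consistent P.vars P.main ∧
    ∀ X, NoSelfComm (P.procs X) ∧ Initial (P.procs X) ∧ WellAnn P X

/-- Transitions of choreographies, lower layer: `Step D C s t C' s'` is `⟨C,s⟩ --[t,D]--> ⟨C',s'⟩`.
Lists of processes are treated as sets: `ps.toFinset.card` is the number of distinct
processes in `ps`, and `ps.filter (· ≠ p)` is `ps` without `p`. -/
inductive Step (D : DefSet S R) :
    Choreography S R → State S → RichLabel S R → Choreography S R → State S → Prop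
  | com {p e q x a C s v s'} (hv : v = S.eval e (s p)) (hs : s' = s.update q x v) :
      Step D (.interaction (.com p e q x) a C) s (.com p v q x) C s'
  | sel {p q l a C s s'} (hs : s = s') :
      Step D (.interaction (.sel p q l) a C) s (.sel p q l) C s'
  | condThen {p b C₁ C₂ s s'} (hb : S.beval b (s p) = true) (hs : s = s') :
      Step D (.cond p b C₁ C₂) s (.cond p) C₁ s'
  | condElse {p b C₁ C₂ s s'} (hb : S.beval b (s p) = false) (hs : s = s') :
      Step D (.cond p b C₁ C₂) s (.cond p) C₂ s'
  | delayEta {eta a C s t C' s'} (hd : t.DisjointPs eta.pn) (h : Step D C s t C' s') :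
      Step D (.interaction eta a C) s t (.interaction eta a C') s'
  | delayCond {p b C₁ C₂ s t C₁' C₂' s'} (hd : t.DisjointP p)
      (h₁ : Step D C₁ s t C₁' s') (h₂ : Step D C₂ s t C₂' s') :
      Step D (.cond p b C₁ C₂) s t (.cond p b C₁' C₂') s'
  | delayCall {X ps C s t C' s'} (hd : t.DisjointPs ps) (h : Step D C s t C' s') :
      Step D (.rtCall X ps C) s t (.rtCall X ps C') s'
  | callLocal {X p s s'} (hs : s = s') (hc : (D X).1.toFinset.card = 1) (hp : p ∈ (D X).1) :
      Step D (.call X) s (.call X p) (D X).2 s'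
  | callStart {X p s s'} (hs : s = s') (hc : 1 < (D X).1.toFinset.card) (hp : p ∈ (D X).1) :
      Step D (.call X) s (.call X p) (.rtCall X ((D X).1.filter (· ≠ p)) (D X).2) s'
  | callEnter {X ps p C s s'} (hs : s = s') (hc : 1 < ps.toFinset.card) (hp : p ∈ ps) :
      Step D (.rtCall X ps C) s (.call X p) (.rtCall X (ps.filter (· ≠ p)) C) s'
  | callFinish {X ps p C s s'} (hs : s = s') (hc : ps.toFinset.card = 1) (hp : p ∈ ps) :
      Step D (.rtCall X ps C) s (.call X p) C s'

abbrev Configuration (S : Signature.{u}) (R : Type v) : Type (max u v) := Program S R × State S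

/-- Transitions of configurations, middle layer. -/
inductive StepP : Configuration S R → TransitionLabel S → Configuration S R → Prop
  | base {D : DefSet S R} {C C' : Choreography S R} {s s' : State S} {t : RichLabel S R}
      (h : Step D C s t C' s') : StepP (⟨D, C⟩, s) t.forget (⟨D, C'⟩, s')

/-- Multi-step transitions of configurations, top layer. -/
inductive StepStar : Configuration S R → List (TransitionLabel S) → Configuration S R → Prop
  | base {P : Program S R} {s s' : State S} (hs : s = s') : StepStar (P, s) [] (P, s')
  | step {c₁ c₂ c₃ : Configuration S R} {t : TransitionLabel S} {l : List (TransitionLabel S)}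
      (h₁ : StepP c₁ t c₂) (h₂ : StepStar c₂ l c₃) : StepStar c₁ (t :: l) c₃

end CC

/-! ### The process language SP -/

namespace SP

/-- Behaviours of single processes.  `branching p mBl mBr` waits for a label from `p`, offering the
behaviours `mBl` for `left` and `mBr` for `right` (when present). -/
inductive Behaviour (S : Signature.{u}) (R : Type v) : Type (max u v)
  | nil
  | send (p : S.Pid) (e : S.Expr) (a : S.Ann) (B : Behaviour S R)
  | recv (p : S.Pid) (x : S.Var) (a : S.Ann) (B : Behaviour S R)
  | sel (p : S.Pid) (l : Label) (a : S.Ann) (B : Behaviour S R)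
  | branching (p : S.Pid) (mBl mBr : Option (S.Ann × Behaviour S R))
  | cond (b : S.BExpr) (B₁ B₂ : Behaviour S R)
  | call (X : R)

abbrev Network (S : Signature.{u}) (R : Type v) : Type (max u v) := S.Pid → Behaviour S R

abbrev DefSetB (S : Signature.{u}) (R : Type v) : Type (max u v) := R → Behaviour S R

structure Program (S : Signature.{u}) (R : Type v) : Type (max u v) where
  procs : DefSetB S R
  net : Network S R

variable {S : Signature.{u}} {R : Type v}

/-- The singleton network `p[B]`. -/
def Network.single (p : S.Pid) (B : Behaviour S R) : Network S R :=
  fun q => if q = p then B else .nil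

/-- Parallel composition `N | N'`. -/
def Network.par (N N' : Network S R) : Network S R := fun p =>
  match N p with
  | .nil => N' p
  | B => B

/-- Removal `N \ p`. -/
def Network.rm (N : Network S R) (p : S.Pid) : Network S R :=
  fun q => if q = p then .nil else N q

/-- `N \ p | p[B]`. -/
def Network.set (N : Network S R) (p : S.Pid) (B : Behaviour S R) : Network S R :=
  (N.rm p).par (.single p B)

/-- `N \ p \ q | p[B] | q[B']`. -/
def Network.set₂ (N : Network S R) (p q : S.Pid) (B B' : Behaviour S R) : Network S R :=
  (((N.rm p).rm q).par (.single p B)).par (.single q B')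

/-- Transitions of networks, lower layer: `Step D N s t N' s'` is `⟨N,s⟩ --[t,D]--> ⟨N',s'⟩`. -/
inductive Step (D : DefSetB S R) :
    Network S R → State S → RichLabel S R → Network S R → State S → Prop
  | com {N : Network S R} {p q e x a a' B B' s v N' s'}
      (hp : N p = .send q e a B) (hq : N q = .recv p x a' B')
      (hv : v = S.eval e (s p)) (hN : N' = N.set₂ p q B B') (hs : s' = s.update q x v) :
      Step D N s (.com p v q x) N' s'
  | selLeft {N : Network S R} {p q a a' B Bl mBr s N' s'}
      (hp : N p = .sel q .left a B) (hq : N q = .branching p (some (a', Bl)) mBr)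
      (hN : N' = N.set₂ p q B Bl) (hs : s = s') :
      Step D N s (.sel p q .left) N' s'
  | selRight {N : Network S R} {p q a a' B mBl Br s N' s'}
      (hp : N p = .sel q .right a B) (hq : N q = .branching p mBl (some (a', Br)))
      (hN : N' = N.set₂ p q B Br) (hs : s = s') :
      Step D N s (.sel p q .right) N' s'
  | condThen {N : Network S R} {p b B₁ B₂ s N' s'}
      (hp : N p = .cond b B₁ B₂) (hb : S.beval b (s p) = true)
      (hN : N' = N.set p B₁) (hs : s = s') :
      Step D N s (.cond p) N' s'
  | condElse {N : Network S R} {p b B₁ B₂ s N' s'}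
      (hp : N p = .cond b B₁ B₂) (hb : S.beval b (s p) = false)
      (hN : N' = N.set p B₂) (hs : s = s') :
      Step D N s (.cond p) N' s'
  | call {N : Network S R} {p X s N' s'}
      (hp : N p = .call X) (hN : N' = N.set p (D X)) (hs : s = s') :
      Step D N s (.call X p) N' s'

abbrev Configuration (S : Signature.{u}) (R : Type v) : Type (max u v) := Program S R × State S

/-- Transitions of configurations, middle layer. -/
inductive StepP : Configuration S R → TransitionLabel S → Configuration S R → Prop
  | base {D : DefSetB S R} {N N' : Network S R} {s s' : State S} {t : RichLabel S R}
      (h : Step D N s t N' s') : StepP (⟨D, N⟩, s) t.forget (⟨D, N'⟩, s')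

/-- Multi-step transitions of configurations, top layer. -/
inductive StepStar : Configuration S R → List (TransitionLabel S) → Configuration S R → Prop
  | base {P : Program S R} {s s' : State S} (hs : s = s') : StepStar (P, s) [] (P, s')
  | step {c₁ c₂ c₃ : Configuration S R} {t : TransitionLabel S} {l : List (TransitionLabel S)}
      (h₁ : StepP c₁ t c₂) (h₂ : StepStar c₂ l c₃) : StepStar c₁ (t :: l) c₃

/-- The branching order: `MoreBranches B B'` is `B [>>] B'`. -/
inductive MoreBranches : Behaviour S R → Behaviour S R → Prop
  | nil : MoreBranches .nil .nil
  | send {p e a B B'} (h : MoreBranches B B') : MoreBranches (.send p e a B) (.send p e a B')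
  | recv {p x a B B'} (h : MoreBranches B B') : MoreBranches (.recv p x a B) (.recv p x a B')
  | sel {p l a B B'} (h : MoreBranches B B') : MoreBranches (.sel p l a B) (.sel p l a B')
  | branchingNN {p mBl mBr} : MoreBranches (.branching p mBl mBr) (.branching p none none)
  | branchingNS {p mBl a Br Br'} (h : MoreBranches Br Br') :
      MoreBranches (.branching p mBl (some (a, Br))) (.branching p none (some (a, Br')))
  | branchingSN {p a Bl Bl' mBr} (h : MoreBranches Bl Bl') :
      MoreBranches (.branching p (some (a, Bl)) mBr) (.branching p (some (a, Bl')) none)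
  | branchingSS {p a Bl Bl' a' Br Br'} (hl : MoreBranches Bl Bl') (hr : MoreBranches Br Br') :
      MoreBranches (.branching p (some (a, Bl)) (some (a', Br)))
        (.branching p (some (a, Bl')) (some (a', Br')))
  | cond {b B₁ B₂ B₁' B₂'} (h₁ : MoreBranches B₁ B₁') (h₂ : MoreBranches B₂ B₂') :
      MoreBranches (.cond b B₁ B₂) (.cond b B₁' B₂')
  | call {X} : MoreBranches (.call X) (.call X)

/-- The pointwise branching order on networks, `N (>>) N'`. -/
def MoreBranchesN (N N' : Network S R) : Prop := ∀ p, MoreBranches (N p) (N' p)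

/-- Merging: `Merge B₁ B₂ B` is `B₁ [V] B₂ == B`.  The letters in the names of the
branching clauses say, in this order, which of the left and right branch of `B₁` and the left and
right branch of `B₂` are present (`S`) or absent (`N`). -/
inductive Merge : Behaviour S R → Behaviour S R → Behaviour S R → Prop
  | nil : Merge .nil .nil .nil
  | send {p e a B₁ B₂ B} (h : Merge B₁ B₂ B) :
      Merge (.send p e a B₁) (.send p e a B₂) (.send p e a B)
  | recv {p x a B₁ B₂ B} (h : Merge B₁ B₂ B) :
      Merge (.recv p x a B₁) (.recv p x a B₂) (.recv p x a B)
  | sel {p l a B₁ B₂ B} (h : Merge B₁ B₂ B) :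
      Merge (.sel p l a B₁) (.sel p l a B₂) (.sel p l a B)
  | branchingNNNN {p} :
      Merge (.branching p none none) (.branching p none none) (.branching p none none)
  | branchingNNNS {p r} :
      Merge (.branching p none none) (.branching p none (some r)) (.branching p none (some r))
  | branchingNNSN {p l} :
      Merge (.branching p none none) (.branching p (some l) none) (.branching p (some l) none)
  | branchingNNSS {p l r} :
      Merge (.branching p none none) (.branching p (some l) (some r))
        (.branching p (some l) (some r))
  | branchingNSNN {p r} :
      Merge (.branching p none (some r)) (.branching p none none) (.branching p none (some r))
  | branchingNSNS {p aR bR₁ bR₂ bR} (h : Merge bR₁ bR₂ bR) :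
      Merge (.branching p none (some (aR, bR₁))) (.branching p none (some (aR, bR₂)))
        (.branching p none (some (aR, bR)))
  | branchingNSSN {p l r} :
      Merge (.branching p none (some r)) (.branching p (some l) none)
        (.branching p (some l) (some r))
  | branchingNSSS {p l aR bR₁ bR₂ bR} (h : Merge bR₁ bR₂ bR) :
      Merge (.branching p none (some (aR, bR₁))) (.branching p (some l) (some (aR, bR₂)))
        (.branching p (some l) (some (aR, bR)))
  | branchingSNNN {p l} :
      Merge (.branching p (some l) none) (.branching p none none) (.branching p (some l) none)
  | branchingSNNS {p l r} :
      Merge (.branching p (some l) none) (.branching p none (some r))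
        (.branching p (some l) (some r))
  | branchingSNSN {p aL bL₁ bL₂ bL} (h : Merge bL₁ bL₂ bL) :
      Merge (.branching p (some (aL, bL₁)) none) (.branching p (some (aL, bL₂)) none)
        (.branching p (some (aL, bL)) none)
  | branchingSNSS {p aL bL₁ bL₂ bL r} (h : Merge bL₁ bL₂ bL) :
      Merge (.branching p (some (aL, bL₁)) none) (.branching p (some (aL, bL₂)) (some r))
        (.branching p (some (aL, bL)) (some r))
  | branchingSSNN {p l r} :
      Merge (.branching p (some l) (some r)) (.branching p none none)
        (.branching p (some l) (some r))
  | branchingSSNS {p l aR bR₁ bR₂ bR} (h : Merge bR₁ bR₂ bR) :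
      Merge (.branching p (some l) (some (aR, bR₁))) (.branching p none (some (aR, bR₂)))
        (.branching p (some l) (some (aR, bR)))
  | branchingSSSN {p aL bL₁ bL₂ bL r} (h : Merge bL₁ bL₂ bL) :
      Merge (.branching p (some (aL, bL₁)) (some r)) (.branching p (some (aL, bL₂)) none)
        (.branching p (some (aL, bL)) (some r))
  | branchingSSSS {p aL bL₁ bL₂ bL aR bR₁ bR₂ bR}
      (hl : Merge bL₁ bL₂ bL) (hr : Merge bR₁ bR₂ bR) :
      Merge (.branching p (some (aL, bL₁)) (some (aR, bR₁)))
        (.branching p (some (aL, bL₂)) (some (aR, bR₂)))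
        (.branching p (some (aL, bL)) (some (aR, bR)))
  | cond {b Bt₁ Be₁ Bt₂ Be₂ Bt Be} (ht : Merge Bt₁ Bt₂ Bt) (he : Merge Be₁ Be₂ Be) :
      Merge (.cond b Bt₁ Be₁) (.cond b Bt₂ Be₂) (.cond b Bt Be)
  | call {X} : Merge (.call X) (.call X) (.call X)

end SP

/-! ### Endpoint projection -/

namespace EPP

open CC SP

variable {S : Signature.{u}} {R : Type v}

/-- Projection of a choreography for one process: `Bproj D C p B` is `[[D,C | p]] == B`.
The procedure names of the target are pairs of a procedure name and a process. -/
inductive Bproj (D : DefSet S R) :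
    Choreography S R → S.Pid → Behaviour S (R × S.Pid) → Prop
  | nil {p} : Bproj D .nil p .nil
  | send {p e q x a C B} (h : Bproj D C p B) :
      Bproj D (.interaction (.com p e q x) a C) p (.send q e a B)
  | recv {p e q x a C B} (hpq : p ≠ q) (h : Bproj D C q B) :
      Bproj D (.interaction (.com p e q x) a C) q (.recv p x a B)
  | com {p e q x a C r B} (hp : p ≠ r) (hq : q ≠ r) (h : Bproj D C r B) :
      Bproj D (.interaction (.com p e q x) a C) r B
  | pick {p q l a C B} (h : Bproj D C p B) :
      Bproj D (.interaction (.sel p q l) a C) p (.sel q l a B)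
  | left {p q a C B} (hpq : p ≠ q) (h : Bproj D C q B) :
      Bproj D (.interaction (.sel p q .left) a C) q (.branching p (some (a, B)) none)
  | right {p q a C B} (hpq : p ≠ q) (h : Bproj D C q B) :
      Bproj D (.interaction (.sel p q .right) a C) q (.branching p none (some (a, B)))
  | sel {p q l a C r B} (hp : p ≠ r) (hq : q ≠ r) (h : Bproj D C r B) :
      Bproj D (.interaction (.sel p q l) a C) r B
  | cond {p b C₁ C₂ B₁ B₂} (h₁ : Bproj D C₁ p B₁) (h₂ : Bproj D C₂ p B₂) :
      Bproj D (.cond p b C₁ C₂) p (.cond b B₁ B₂)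
  | cond' {p b C₁ C₂ r B₁ B₂ B} (hp : p ≠ r) (h₁ : Bproj D C₁ r B₁) (h₂ : Bproj D C₂ r B₂)
      (hB : Merge B₁ B₂ B) : Bproj D (.cond p b C₁ C₂) r B
  | callIn {X p} (hp : p ∈ (D X).1) : Bproj D (.call X) p (.call (X, p))
  | callOut {X p} (hp : p ∉ (D X).1) : Bproj D (.call X) p .nil
  | rtCallIn {X ps C p} (hp : p ∈ ps) : Bproj D (.rtCall X ps C) p (.call (X, p))
  | rtCallOut {X ps C p B} (hp : p ∉ ps) (h : Bproj D C p B) : Bproj D (.rtCall X ps C) p B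

def ProjectableB (D : DefSet S R) (C : Choreography S R) (p : S.Pid) : Prop :=
  ∃ B, Bproj D C p B

def ProjectableC (D : DefSet S R) (C : Choreography S R) (ps : List S.Pid) : Prop :=
  ∀ p ∈ ps, ProjectableB D C p

def ProjectableD (D : DefSet S R) : Prop := ∀ X, ProjectableC D (D X).2 (D X).1

/-- Projectable programs. -/
def ProjectableP (P : CC.Program S R) : Prop :=
  ProjectableC P.procedures P.main P.pn ∧ ProjectableD P.procedures

/-- The network of the projections of `C` for the processes in `ps`.  (The relation `Bproj D C p` is
functional, so the chosen behaviour is the only one.) -/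
noncomputable def eppC (D : DefSet S R) (ps : List S.Pid) (C : Choreography S R)
    (H : ProjectableC D C ps) : Network S (R × S.Pid) :=
  fun p => if hp : p ∈ ps then (H p hp).choose else .nil

/-- The projected procedure definitions. -/
noncomputable def eppD (D : DefSet S R) (H : ProjectableD D) : DefSetB S (R × S.Pid) :=
  fun X => if hp : X.2 ∈ (D X.1).1 then (H X.1 X.2 hp).choose else .nil

/-- Endpoint projection of a program. -/
noncomputable def epp (P : CC.Program S R) (H : ProjectableP P) : SP.Program S (R × S.Pid) where
  procs := eppD P.procedures H.2
  net := eppC P.procedures P.pn P.main H.1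

/-- Strong projectability of a choreography for a process. -/
def StrProj (D : DefSet S R) : Choreography S R → S.Pid → Prop
  | .interaction _ _ C, r => StrProj D C r
  | .cond p b C₁ C₂, r => StrProj D C₁ r ∧ StrProj D C₂ r ∧ ProjectableB D (.cond p b C₁ C₂) r
  | .rtCall X ps C, r => StrProj D C r ∧
      ∀ p ∈ ps, ∀ B B', Bproj D (D X).2 p B → Bproj D C p B' → MoreBranches B B'
  | .call _, _ => True
  | .nil, _ => True

/-- Strong projectability of a program; this includes well-formedness. -/
def StrProjP (P : CC.Program S R) : Prop :=
  ProgramWF P ∧ ProjectableD P.procedures ∧ ∀ r, StrProj P.procedures P.main r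

end EPP

end CoreChor

namespace CoreChor

open CC SP EPP

variable {S : Signature.{u}} {R : Type v}

/-! ### The branching order and merge -/

namespace SP

/-! The proof is a simulation whose invariant, `Refines D N C`, relates an arbitrary network `N` to
a choreography `C`: `C` is strongly projectable, and `N r` lies above the projection of `C` for
every `r`. Equality with the projection is not preserved: resolving a conditional leaves the other
processes with the merge of both branches. Since `N` need not be a projection, the one-step result
can be iterated.

Two facts carry a step. First, where `N` acts, the projections below it have the same head
constructors, and a projection starts with an action only if `C` can execute that action past
constructs not involving its processes, in both branches of every conditional crossed
(`exists_step_com` and its analogues). Hence `C` has a transition with the same observable label.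
Second, when `C` steps to `C'`, the projection for `r` plays the part of `r` in the label and lands
above the projection of `C'` (`bproj_step`). Local steps are monotone for the branching order, so
the new network is above the projection of `C'` too.

The delicate point is that `C'` is again strongly projectable. Under a conditional of another
process, the two residual projections lie below the residual of their merge, and behaviours with a
common upper bound can be merged (`Merge.exists_of_moreBranches`). For a process joining a call
late, the runtime clause of `StrProj` puts the projection of the original body above that of the
evolved one; this survives because delayed steps involve no waiting process. -/

theorem MoreBranches.refl : ∀ B : Behaviour S R, MoreBranches B B
  | .nil => .nil
  | .send _ _ _ B => .send (refl B)
  | .recv _ _ _ B => .recv (refl B)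
  | .sel _ _ _ B => .sel (refl B)
  | .branching _ none none => .branchingNN
  | .branching _ none (some (_, Br)) => .branchingNS (refl Br)
  | .branching _ (some (_, Bl)) none => .branchingSN (refl Bl)
  | .branching _ (some (_, Bl)) (some (_, Br)) => .branchingSS (refl Bl) (refl Br)
  | .cond _ B₁ B₂ => .cond (refl B₁) (refl B₂)
  | .call _ => .call

theorem MoreBranches.trans {B₁ B₂ B₃ : Behaviour S R} (h₁ : MoreBranches B₁ B₂)
    (h₂ : MoreBranches B₂ B₃) : MoreBranches B₁ B₃ := by
  induction h₁ generalizing B₃ with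
  | nil => exact h₂
  | call => exact h₂
  | send _ ih => cases h₂ with | send h => exact .send (ih h)
  | recv _ ih => cases h₂ with | recv h => exact .recv (ih h)
  | sel _ ih => cases h₂ with | sel h => exact .sel (ih h)
  | branchingNN => cases h₂; exact .branchingNN
  | branchingNS _ ih =>
    cases h₂ with
    | branchingNN => exact .branchingNN
    | branchingNS h => exact .branchingNS (ih h)
  | branchingSN _ ih =>
    cases h₂ with
    | branchingNN => exact .branchingNN
    | branchingSN h => exact .branchingSN (ih h)
  | branchingSS _ _ ihl ihr =>
    cases h₂ with
    | branchingNN => exact .branchingNN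
    | branchingNS h => exact .branchingNS (ihr h)
    | branchingSN h => exact .branchingSN (ihl h)
    | branchingSS hl hr => exact .branchingSS (ihl hl) (ihr hr)
  | cond _ _ ih₁ ih₂ => cases h₂ with | cond h h' => exact .cond (ih₁ h) (ih₂ h')

theorem Merge.unique {B₁ B₂ B B' : Behaviour S R} (h : Merge B₁ B₂ B) (h' : Merge B₁ B₂ B') :
    B = B' := by
  induction h generalizing B' with
  | send _ ih | recv _ ih | sel _ ih | branchingNSNS _ ih | branchingNSSS _ ih
  | branchingSNSN _ ih | branchingSNSS _ ih | branchingSSNS _ ih | branchingSSSN _ ih =>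
    cases h'; rename_i h; rw [ih h]
  | branchingSSSS _ _ ih₁ ih₂ | cond _ _ ih₁ ih₂ =>
    cases h'; rename_i h₁ h₂; rw [ih₁ h₁, ih₂ h₂]
  | _ => cases h'; rfl

/-- Merging only adds offers to either argument. With the next lemma this makes `Merge` the join of
any pair that is bounded above. -/
theorem Merge.moreBranches {B₁ B₂ B : Behaviour S R} (h : Merge B₁ B₂ B) :
    MoreBranches B B₁ ∧ MoreBranches B B₂ := by
  induction h <;> constructor <;>
    first
    | exact .refl _
    | constructor <;> first | exact .refl _ | simp_all

/-- Behaviours with a common upper bound have a merge, which is their least upper bound. -/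
theorem Merge.exists_of_moreBranches {B B₁ B₂ : Behaviour S R} (h₁ : MoreBranches B B₁)
    (h₂ : MoreBranches B B₂) : ∃ M, Merge B₁ B₂ M ∧ MoreBranches B M := by
  induction h₁ generalizing B₂ with
  | nil => cases h₂; exact ⟨_, .nil, .nil⟩
  | call => cases h₂; exact ⟨_, .call, .call⟩
  | send _ ih => cases h₂ with | send h => obtain ⟨M, hM, hB⟩ := ih h; exact ⟨_, .send hM, .send hB⟩
  | recv _ ih => cases h₂ with | recv h => obtain ⟨M, hM, hB⟩ := ih h; exact ⟨_, .recv hM, .recv hB⟩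
  | sel _ ih => cases h₂ with | sel h => obtain ⟨M, hM, hB⟩ := ih h; exact ⟨_, .sel hM, .sel hB⟩
  | branchingNN =>
    cases h₂ with
    | branchingNN => exact ⟨_, .branchingNNNN, .branchingNN⟩
    | branchingNS h => exact ⟨_, .branchingNNNS, .branchingNS h⟩
    | branchingSN h => exact ⟨_, .branchingNNSN, .branchingSN h⟩
    | branchingSS hl hr => exact ⟨_, .branchingNNSS, .branchingSS hl hr⟩
  | branchingNS h₁ ih =>
    cases h₂ with
    | branchingNN => exact ⟨_, .branchingNSNN, .branchingNS h₁⟩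
    | branchingNS h => obtain ⟨M, hM, hB⟩ := ih h; exact ⟨_, .branchingNSNS hM, .branchingNS hB⟩
    -- Each argument contributes one label, so the offers are juxtaposed and no continuations need
    -- merging.
    | branchingSN h => exact ⟨_, .branchingNSSN, .branchingSS h h₁⟩
    | branchingSS hl hr =>
      obtain ⟨M, hM, hB⟩ := ih hr; exact ⟨_, .branchingNSSS hM, .branchingSS hl hB⟩
  | branchingSN h₁ ih =>
    cases h₂ with
    | branchingNN => exact ⟨_, .branchingSNNN, .branchingSN h₁⟩
    | branchingNS h => exact ⟨_, .branchingSNNS, .branchingSS h₁ h⟩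
    | branchingSN h => obtain ⟨M, hM, hB⟩ := ih h; exact ⟨_, .branchingSNSN hM, .branchingSN hB⟩
    | branchingSS hl hr =>
      obtain ⟨M, hM, hB⟩ := ih hl; exact ⟨_, .branchingSNSS hM, .branchingSS hB hr⟩
  | branchingSS h₁ h₁' ihl ihr =>
    cases h₂ with
    | branchingNN => exact ⟨_, .branchingSSNN, .branchingSS h₁ h₁'⟩
    | branchingNS h =>
      obtain ⟨M, hM, hB⟩ := ihr h; exact ⟨_, .branchingSSNS hM, .branchingSS h₁ hB⟩
    | branchingSN h =>
      obtain ⟨M, hM, hB⟩ := ihl h; exact ⟨_, .branchingSSSN hM, .branchingSS hB h₁'⟩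
    | branchingSS hl hr =>
      obtain ⟨M, hM, hB⟩ := ihl hl
      obtain ⟨M', hM', hB'⟩ := ihr hr
      exact ⟨_, .branchingSSSS hM hM', .branchingSS hB hB'⟩
  | cond _ _ ih₁ ih₂ =>
    cases h₂ with
    | cond h h' =>
      obtain ⟨M, hM, hB⟩ := ih₁ h
      obtain ⟨M', hM', hB'⟩ := ih₂ h'
      exact ⟨_, .cond hM hM', .cond hB hB'⟩

theorem Network.set_same (N : Network S R) (p : S.Pid) (B : Behaviour S R) : N.set p B p = B := by
  simp [Network.set, Network.par, Network.rm, Network.single]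

theorem Network.set_of_ne (N : Network S R) {p r : S.Pid} (B : Behaviour S R) (h : r ≠ p) :
    N.set p B r = N r := by
  simp only [Network.set, Network.par, Network.rm, Network.single, if_neg h]
  cases N r <;> rfl

theorem Network.set₂_left (N : Network S R) {p q : S.Pid} (B B' : Behaviour S R) (h : p ≠ q) :
    N.set₂ p q B B' p = B := by
  simp only [Network.set₂, Network.par, Network.rm, Network.single, if_neg h, if_true]
  -- If `B` is `.nil`, parallel composition falls through to the singleton at `q`, which is also
  -- `.nil` at `p` because `p ≠ q`.
  cases B <;> rfl

theorem Network.set₂_right (N : Network S R) {p q : S.Pid} (B B' : Behaviour S R) (h : p ≠ q) :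
    N.set₂ p q B B' q = B' := by
  simp [Network.set₂, Network.par, Network.rm, Network.single, h.symm]

theorem Network.set₂_of_ne (N : Network S R) {p q r : S.Pid} (B B' : Behaviour S R) (hp : r ≠ p)
    (hq : r ≠ q) : N.set₂ p q B B' r = N r := by
  simp only [Network.set₂, Network.par, Network.rm, Network.single, if_neg hp, if_neg hq]
  cases N r <;> rfl

end SP

/-! ### Basic properties of projection -/

namespace EPP

theorem Bproj.unique {D : DefSet S R} {C : Choreography S R} {p : S.Pid}
    {B B' : Behaviour S (R × S.Pid)} (h : Bproj D C p B) (h' : Bproj D C p B') : B = B' := by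
  induction h generalizing B' with
  | nil => cases h'; rfl
  | send _ ih | recv _ _ ih | com _ _ _ ih | pick _ ih | left _ _ ih | right _ _ ih
  | sel _ _ _ ih =>
    cases h' <;> first | contradiction | (rename_i h; rw [ih h])
  | cond _ _ ih₁ ih₂ =>
    cases h' with
    | cond h₁ h₂ => rw [ih₁ h₁, ih₂ h₂]
    | cond' hp => contradiction
  | cond' _ _ _ hB ih₁ ih₂ =>
    cases h' with
    | cond h₁ h₂ => contradiction
    | cond' _ h₁ h₂ hB' =>
      obtain rfl := ih₁ h₁
      obtain rfl := ih₂ h₂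
      exact hB.unique hB'
  | callIn => cases h' <;> first | rfl | contradiction
  | callOut => cases h' <;> first | rfl | contradiction
  | rtCallIn => cases h' <;> first | rfl | contradiction
  | rtCallOut _ _ ih =>
    cases h' with
    | rtCallIn => contradiction
    | rtCallOut _ h => exact ih h

/-- Every construct skips an uninvolved process, and at a conditional both projections are `.nil`,
which merge. -/
theorem Bproj.of_notMem_pn {D : DefSet S R} {p : S.Pid} :
    ∀ {C : Choreography S R}, p ∉ CC.pn (fun X => (D X).1) C → Bproj D C p .nil
  | .interaction (.com q e r x) a C, h => by
    simp only [CC.pn, Eta.pn, List.mem_append, List.mem_cons, List.not_mem_nil, or_false,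
      not_or] at h
    exact .com (Ne.symm h.1.1) (Ne.symm h.1.2) (of_notMem_pn h.2)
  | .interaction (.sel q r l) a C, h => by
    simp only [CC.pn, Eta.pn, List.mem_append, List.mem_cons, List.not_mem_nil, or_false,
      not_or] at h
    exact .sel (Ne.symm h.1.1) (Ne.symm h.1.2) (of_notMem_pn h.2)
  | .cond q b C₁ C₂, h => by
    simp only [CC.pn, List.mem_append, List.mem_cons, not_or] at h
    exact .cond' (Ne.symm h.1) (of_notMem_pn h.2.1) (of_notMem_pn h.2.2) .nil
  | .call X, h => .callOut h
  | .rtCall X ps C, h => by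
    simp only [CC.pn, List.mem_append, not_or] at h
    exact .rtCallOut h.1 (of_notMem_pn h.2)
  | .nil, _ => .nil

theorem ProjectableB.interaction {D : DefSet S R} {C : Choreography S R} {r : S.Pid}
    (h : ProjectableB D C r) (eta : Eta S) (a : S.Ann) :
    ProjectableB D (.interaction eta a C) r := by
  obtain ⟨B, hB⟩ := h
  cases eta with
  | com p e q x =>
    by_cases hp : p = r
    · subst hp; exact ⟨_, .send hB⟩
    by_cases hq : q = r
    · subst hq; exact ⟨_, .recv hp hB⟩
    exact ⟨_, .com hp hq hB⟩
  | sel p q l =>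
    by_cases hp : p = r
    · subst hp; exact ⟨_, .pick hB⟩
    by_cases hq : q = r
    · subst hq
      cases l
      · exact ⟨_, .left hp hB⟩
      · exact ⟨_, .right hp hB⟩
    exact ⟨_, .sel hp hq hB⟩

/-- Only the merge at a conditional can make projection fail, and there `StrProj` demands
projectability outright. -/
theorem StrProj.projectableB {D : DefSet S R} {r : S.Pid} :
    ∀ {C : Choreography S R}, StrProj D C r → ProjectableB D C r
  | .interaction eta a C, h => (projectableB (C := C) h).interaction eta a
  | .cond _ _ _ _, h => h.2.2
  | .call X, _ => by
    by_cases hr : r ∈ (D X).1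
    · exact ⟨_, .callIn hr⟩
    · exact ⟨_, .callOut hr⟩
  | .rtCall X ps C, h => by
    by_cases hr : r ∈ ps
    · exact ⟨_, .rtCallIn hr⟩
    · obtain ⟨B, hB⟩ := projectableB h.1
      exact ⟨B, .rtCallOut hr hB⟩
  | .nil, _ => ⟨_, .nil⟩

/-- A derivation of a projection without runtime terms visits all conditional subterms, and only
runtime terms would demand more. -/
theorem Bproj.strProj {D : DefSet S R} {C : Choreography S R} {r : S.Pid}
    {B : Behaviour S (R × S.Pid)} (h : Bproj D C r B) (hC : Initial C) : StrProj D C r := by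
  induction h with
  | nil | callIn | callOut => trivial
  | send _ ih | recv _ _ ih | com _ _ _ ih | pick _ ih | left _ _ ih | right _ _ ih
  | sel _ _ _ ih => exact ih hC
  | cond h₁ h₂ ih₁ ih₂ => exact ⟨ih₁ hC.1, ih₂ hC.2, _, .cond h₁ h₂⟩
  | cond' hp h₁ h₂ hB ih₁ ih₂ => exact ⟨ih₁ hC.1, ih₂ hC.2, _, .cond' hp h₁ h₂ hB⟩
  | rtCallIn | rtCallOut => exact hC.elim

/-- `D'` consists of the projections of the procedure bodies of `D`, all of which are initial and
only involve their declared processes. -/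
structure ProjectsTo (D : DefSet S R) (D' : DefSetB S (R × S.Pid)) : Prop where
  initial : ∀ X, Initial (D X).2
  bproj : ∀ X p, Bproj D (D X).2 p (D' (X, p))
  nil : ∀ X, ∀ p ∉ (D X).1, D' (X, p) = .nil

namespace ProjectsTo

variable {D : DefSet S R} {D' : DefSetB S (R × S.Pid)}

theorem bproj_nil (hD : ProjectsTo D D') {X : R} {p : S.Pid} (hp : p ∉ (D X).1) :
    Bproj D (D X).2 p .nil :=
  hD.nil X p hp ▸ hD.bproj X p

theorem strProj_body (hD : ProjectsTo D D') (X : R) (r : S.Pid) : StrProj D (D X).2 r :=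
  (hD.bproj X r).strProj (hD.initial X)

end ProjectsTo

/-! ### The effect of a label on a single process -/

/-- `LocalStep D' s t r B B'`: in state `s`, the process `r` with behaviour `B` can play its role in
an action labelled `t`, and then continues as `B'`. -/
inductive LocalStep (D' : DefSetB S (R × S.Pid)) (s : State S) :
    RichLabel S R → S.Pid → Behaviour S (R × S.Pid) → Behaviour S (R × S.Pid) → Prop
  | send {p v q x e a B} : LocalStep D' s (.com p v q x) p (.send q e a B) B
  | recv {p v q x a B} (h : p ≠ q) : LocalStep D' s (.com p v q x) q (.recv p x a B) B
  | sel {p q l a B} : LocalStep D' s (.sel p q l) p (.sel q l a B) B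
  | left {p q a B mBr} (h : p ≠ q) :
      LocalStep D' s (.sel p q .left) q (.branching p (some (a, B)) mBr) B
  | right {p q a B mBl} (h : p ≠ q) :
      LocalStep D' s (.sel p q .right) q (.branching p mBl (some (a, B))) B
  | condThen {p b B₁ B₂} (h : S.beval b (s p) = true) :
      LocalStep D' s (.cond p) p (.cond b B₁ B₂) B₁
  | condElse {p b B₁ B₂} (h : S.beval b (s p) = false) :
      LocalStep D' s (.cond p) p (.cond b B₁ B₂) B₂
  | call {X p} : LocalStep D' s (.call X p) p (.call (X, p)) (D' (X, p))
  | idle {t r B} (h : t.DisjointP r) : LocalStep D' s t r B B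

namespace LocalStep

variable {D' : DefSetB S (R × S.Pid)} {s : State S} {t : RichLabel S R} {r : S.Pid}
  {B B₁ B₂ B' B₁' B₂' : Behaviour S (R × S.Pid)}

theorem eq_of_disjointP (h : LocalStep D' s t r B B') (ht : t.DisjointP r) : B' = B := by
  cases h <;> simp_all [RichLabel.DisjointP]

/-- The label and the state determine which continuation is taken (the selected branch, the outcome
of the guard, the procedure body), so comparable behaviours take corresponding continuations. -/
theorem mono (h₁ : LocalStep D' s t r B₁ B₁') (h₂ : LocalStep D' s t r B₂ B₂')
    (h : MoreBranches B₁ B₂) : MoreBranches B₁' B₂' := by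
  cases h₁ with
  | idle ht => rwa [h₂.eq_of_disjointP ht]
  | call =>
    cases h₂ with
    | call => exact .refl _
    | idle ht => exact absurd rfl ht
  | _ =>
    cases h₂ <;> cases h <;>
      first
      | assumption
      | simp_all [RichLabel.DisjointP]

/-- This makes the residuals of the two branches of a conditional bounded above, hence mergeable. -/
theorem merge (h₁ : LocalStep D' s t r B₁ B₁') (h₂ : LocalStep D' s t r B₂ B₂')
    (h : Merge B₁ B₂ B) :
    ∃ B', LocalStep D' s t r B B' ∧ MoreBranches B' B₁' ∧ MoreBranches B' B₂' := by
  -- The merge keeps every offer of `B₁`, so it can act as well; monotonicity then gives both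
  -- bounds.
  suffices H : ∃ B', LocalStep D' s t r B B' by
    obtain ⟨B', hB'⟩ := H
    exact ⟨B', hB', hB'.mono h₁ h.moreBranches.1, hB'.mono h₂ h.moreBranches.2⟩
  cases h₁ with
  | idle ht => exact ⟨_, .idle ht⟩
  | send => cases h; exact ⟨_, .send⟩
  | recv hpq => cases h; exact ⟨_, .recv hpq⟩
  | sel => cases h; exact ⟨_, .sel⟩
  | left hpq => cases h <;> exact ⟨_, .left hpq⟩
  | right hpq => cases h <;> exact ⟨_, .right hpq⟩
  | condThen hb => cases h; exact ⟨_, .condThen hb⟩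
  | condElse hb => cases h; exact ⟨_, .condElse hb⟩
  | call => cases h; exact ⟨_, .call⟩

end LocalStep

theorem eq_of_mem_of_card_toFinset_eq_one {α : Type*} [DecidableEq α] {l : List α} {a b : α}
    (h : l.toFinset.card = 1) (ha : a ∈ l) (hb : b ∈ l) : a = b :=
  Finset.card_le_one.1 h.le a (by simpa using ha) b (by simpa using hb)

variable {D : DefSet S R} {D' : DefSetB S (R × S.Pid)}

/-- The projection of a choreography follows its transitions, up to the branching order. -/
theorem bproj_step (hD : ProjectsTo D D') {C C' : Choreography S R} {s s' : State S}
    {t : RichLabel S R} (h : CC.Step D C s t C' s') (hC : ∀ r, StrProj D C r) {r : S.Pid}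
    {B : Behaviour S (R × S.Pid)} (hB : Bproj D C r B) :
    ∃ B₀ B', LocalStep D' s t r B B₀ ∧ Bproj D C' r B' ∧ MoreBranches B₀ B' := by
  induction h generalizing B with
  | com hv hs =>
    cases hB with
    | send h => exact ⟨_, _, .send, h, .refl _⟩
    | recv hpq h => exact ⟨_, _, .recv hpq, h, .refl _⟩
    | com hp hq h => exact ⟨_, _, .idle ⟨hp.symm, hq.symm⟩, h, .refl _⟩
  | sel hs =>
    cases hB with
    | pick h => exact ⟨_, _, .sel, h, .refl _⟩
    | left hpq h => exact ⟨_, _, .left hpq, h, .refl _⟩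
    | right hpq h => exact ⟨_, _, .right hpq, h, .refl _⟩
    | sel hp hq h => exact ⟨_, _, .idle ⟨hp.symm, hq.symm⟩, h, .refl _⟩
  | condThen hb hs =>
    cases hB with
    | cond h₁ h₂ => exact ⟨_, _, .condThen hb, h₁, .refl _⟩
    -- A process other than the decider keeps the merge of both branches, of which the choreography
    -- retains only one. Here the branching order is needed.
    | cond' hp h₁ h₂ hM => exact ⟨_, _, .idle hp.symm, h₁, hM.moreBranches.1⟩
  | condElse hb hs =>
    cases hB with
    | cond h₁ h₂ => exact ⟨_, _, .condElse hb, h₂, .refl _⟩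
    | cond' hp h₁ h₂ hM => exact ⟨_, _, .idle hp.symm, h₂, hM.moreBranches.2⟩
  | @delayEta eta a C s t C' s' hd h ih =>
    have disj : r ∈ eta.pn → t.DisjointP r := hd r
    cases hB with
    | send hB =>
      obtain ⟨B₀, B', h₀, h', hm⟩ := ih hC hB
      have ht := disj (by simp [Eta.pn])
      -- A process of the delayed interaction takes no part in the label, so its continuation has
      -- not moved.
      rw [h₀.eq_of_disjointP ht] at hm
      exact ⟨_, _, .idle ht, .send h', .send hm⟩
    | recv hpq hB =>
      obtain ⟨B₀, B', h₀, h', hm⟩ := ih hC hB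
      have ht := disj (by simp [Eta.pn])
      rw [h₀.eq_of_disjointP ht] at hm
      exact ⟨_, _, .idle ht, .recv hpq h', .recv hm⟩
    | com hp hq hB =>
      obtain ⟨B₀, B', h₀, h', hm⟩ := ih hC hB
      exact ⟨_, _, h₀, .com hp hq h', hm⟩
    | pick hB =>
      obtain ⟨B₀, B', h₀, h', hm⟩ := ih hC hB
      have ht := disj (by simp [Eta.pn])
      rw [h₀.eq_of_disjointP ht] at hm
      exact ⟨_, _, .idle ht, .pick h', .sel hm⟩
    | left hpq hB =>
      obtain ⟨B₀, B', h₀, h', hm⟩ := ih hC hB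
      have ht := disj (by simp [Eta.pn])
      rw [h₀.eq_of_disjointP ht] at hm
      exact ⟨_, _, .idle ht, .left hpq h', .branchingSN hm⟩
    | right hpq hB =>
      obtain ⟨B₀, B', h₀, h', hm⟩ := ih hC hB
      have ht := disj (by simp [Eta.pn])
      rw [h₀.eq_of_disjointP ht] at hm
      exact ⟨_, _, .idle ht, .right hpq h', .branchingNS hm⟩
    | sel hp hq hB =>
      obtain ⟨B₀, B', h₀, h', hm⟩ := ih hC hB
      exact ⟨_, _, h₀, .sel hp hq h', hm⟩
  | delayCond hd h₁ h₂ ih₁ ih₂ =>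
    cases hB with
    | cond hB₁ hB₂ =>
      obtain ⟨B₁, B₁', hl₁, hB₁', hm₁⟩ := ih₁ (fun r => (hC r).1) hB₁
      obtain ⟨B₂, B₂', hl₂, hB₂', hm₂⟩ := ih₂ (fun r => (hC r).2.1) hB₂
      rw [hl₁.eq_of_disjointP hd] at hm₁
      rw [hl₂.eq_of_disjointP hd] at hm₂
      exact ⟨_, _, .idle hd, .cond hB₁' hB₂', .cond hm₁ hm₂⟩
    | cond' hp hB₁ hB₂ hM =>
      obtain ⟨B₁, B₁', hl₁, hB₁', hm₁⟩ := ih₁ (fun r => (hC r).1) hB₁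
      obtain ⟨B₂, B₂', hl₂, hB₂', hm₂⟩ := ih₂ (fun r => (hC r).2.1) hB₂
      obtain ⟨B₀, hl, hm₁', hm₂'⟩ := hl₁.merge hl₂ hM
      -- The residual of the merge bounds the residual projections of both branches, so these can be
      -- merged again, below that bound.
      obtain ⟨M, hM', hm⟩ := Merge.exists_of_moreBranches (hm₁'.trans hm₁) (hm₂'.trans hm₂)
      exact ⟨_, _, hl, .cond' hp hB₁' hB₂' hM', hm⟩
  | delayCall hd h ih =>
    cases hB with
    | rtCallIn hr => exact ⟨_, _, .idle (hd _ hr), .rtCallIn hr, .refl _⟩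
    | rtCallOut hr hB =>
      obtain ⟨B₀, B', h₀, h', hm⟩ := ih (fun r => (hC r).1) hB
      exact ⟨_, _, h₀, .rtCallOut hr h', hm⟩
  | callLocal hs hc hp =>
    cases hB with
    | callIn hr =>
      obtain rfl := eq_of_mem_of_card_toFinset_eq_one hc hp hr
      exact ⟨_, _, .call, hD.bproj _ _, .refl _⟩
    | callOut hr =>
      exact ⟨_, _, .idle fun h => hr (h ▸ hp), hD.bproj_nil hr, .refl _⟩
  | @callStart X p s s' hs hc hp =>
    cases hB with
    | callIn hr =>
      by_cases hpr : r = p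
      · subst hpr
        exact ⟨_, _, .call, .rtCallOut (by simp) (hD.bproj _ _), .refl _⟩
      · exact ⟨_, _, .idle hpr, .rtCallIn (by simp [hr, hpr]), .refl _⟩
    | callOut hr =>
      exact ⟨_, _, .idle fun h => hr (h ▸ hp), .rtCallOut (by simp [hr]) (hD.bproj_nil hr),
        .refl _⟩
  | @callEnter X ps p C s s' hs hc hp =>
    cases hB with
    | rtCallIn hr =>
      by_cases hpr : r = p
      · subst hpr
        obtain ⟨B', hB'⟩ := (hC r).1.projectableB
        -- The late process starts from the original body, whereas the choreography has evolved; the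
        -- runtime clause of `StrProj` compares the two.
        exact ⟨_, _, .call, .rtCallOut (by simp) hB', (hC r).2 r hr _ _ (hD.bproj X r) hB'⟩
      · exact ⟨_, _, .idle hpr, .rtCallIn (by simp [hr, hpr]), .refl _⟩
    | rtCallOut hr hB =>
      exact ⟨_, _, .idle fun h => hr (h ▸ hp), .rtCallOut (by simp [hr]) hB, .refl _⟩
  | @callFinish X ps p C s s' hs hc hp =>
    cases hB with
    | rtCallIn hr =>
      obtain rfl := eq_of_mem_of_card_toFinset_eq_one hc hp hr
      obtain ⟨B', hB'⟩ := (hC p).1.projectableB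
      exact ⟨_, _, .call, hB', (hC p).2 p hr _ _ (hD.bproj X p) hB'⟩
    | rtCallOut hr hB => exact ⟨_, _, .idle fun h => hr (h ▸ hp), hB, .refl _⟩

/-- Strong projectability is preserved by transitions. -/
theorem strProj_step (hD : ProjectsTo D D') {C C' : Choreography S R} {s s' : State S}
    {t : RichLabel S R} (h : CC.Step D C s t C' s') (hC : ∀ r, StrProj D C r) (r : S.Pid) :
    StrProj D C' r := by
  induction h with
  | com | sel => exact hC r
  | condThen => exact (hC r).1
  | condElse => exact (hC r).2.1
  | delayEta _ _ ih => exact ih hC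
  | delayCond hd h₁ h₂ ih₁ ih₂ =>
    refine ⟨ih₁ fun r => (hC r).1, ih₂ fun r => (hC r).2.1, ?_⟩
    obtain ⟨B, hB⟩ := (hC r).2.2
    obtain ⟨_, B', _, hB', _⟩ := bproj_step hD (.delayCond hd h₁ h₂) hC hB
    exact ⟨B', hB'⟩
  | delayCall hd h ih =>
    have hC₁ := fun r => (hC r).1
    refine ⟨ih hC₁, fun p hp B B' hB hB' => ?_⟩
    obtain ⟨B₁, hB₁⟩ := (hC₁ p).projectableB
    obtain ⟨B₀, B₂, hl, hB₂, hm⟩ := bproj_step hD h hC₁ hB₁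
    -- A waiting process is idle in the delayed step, so its projection can only decrease, and the
    -- runtime clause persists by transitivity.
    rw [hl.eq_of_disjointP (hd p hp)] at hm
    rw [hB'.unique hB₂]
    exact ((hC r).2 p hp _ _ hB hB₁).trans hm
  | callLocal => exact hD.strProj_body _ r
  | callStart =>
    -- The runtime term has just been created with the unevolved body, so both projections coincide.
    exact ⟨hD.strProj_body _ r, fun p hp B B' hB hB' => hB.unique hB' ▸ .refl _⟩
  | callEnter => exact ⟨(hC r).1, fun p hp => (hC r).2 p (List.mem_of_mem_filter hp)⟩
  | callFinish => exact (hC r).1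

/-! ### Transitions of choreographies from the shape of their projections -/

/-- Skipped constructs do not involve `p` or `q`, so the communication can be delayed past them.
Merging preserves `e`, `q` and `x`, so both branches of a conditional yield the same label and the
same final state. -/
theorem exists_step_com {C : Choreography S R} {p q : S.Pid} {e : S.Expr} {x : S.Var}
    {a a' : S.Ann} {B B' : Behaviour S (R × S.Pid)} (hp : Bproj D C p (.send q e a B))
    (hq : Bproj D C q (.recv p x a' B')) (s : State S) :
    ∃ C', CC.Step D C s (.com p (S.eval e (s p)) q x) C' (s.update q x (S.eval e (s p))) := by
  induction C generalizing B B' with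
  | interaction eta b C ih =>
    cases hp with
    | send h =>
      cases hq with
      | recv => exact ⟨_, .com rfl rfl⟩
      | com => contradiction
    | com h₁ h₂ h =>
      cases hq with
      | recv => contradiction
      | com h₁' h₂' h' =>
        obtain ⟨C', hC'⟩ := ih h h'
        exact ⟨_, .delayEta (by simp [RichLabel.DisjointPs, RichLabel.DisjointP, Eta.pn, *]) hC'⟩
    | sel h₁ h₂ h =>
      cases hq with
      | sel h₁' h₂' h' =>
        obtain ⟨C', hC'⟩ := ih h h'
        exact ⟨_, .delayEta (by simp [RichLabel.DisjointPs, RichLabel.DisjointP, Eta.pn, *]) hC'⟩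
  | cond r b C₁ C₂ ih₁ ih₂ =>
    cases hp with
    | cond' h hp₁ hp₂ hM =>
      cases hq with
      | cond' h' hq₁ hq₂ hM' =>
        cases hM
        cases hM'
        obtain ⟨C₁', hC₁⟩ := ih₁ hp₁ hq₁
        obtain ⟨C₂', hC₂⟩ := ih₂ hp₂ hq₂
        exact ⟨_, .delayCond ⟨h, h'⟩ hC₁ hC₂⟩
  | call X => cases hp
  | rtCall X ps C ih =>
    cases hp with
    | rtCallOut h hp =>
      cases hq with
      | rtCallOut h' hq =>
        obtain ⟨C', hC'⟩ := ih hp hq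
        exact ⟨_, .delayCall (fun r hr => ⟨fun e => h (e ▸ hr), fun e => h' (e ▸ hr)⟩) hC'⟩
  | nil => cases hp

/-- The projection for `q` is not required to offer `l`: the selection by `p` fixes the label, and
the branching only ensures that `q` is not engaged in anything earlier. -/
theorem exists_step_sel {C : Choreography S R} {p q : S.Pid} {l : Label} {a : S.Ann}
    {B : Behaviour S (R × S.Pid)} {mBl mBr : Option (S.Ann × Behaviour S (R × S.Pid))}
    (hp : Bproj D C p (.sel q l a B)) (hq : Bproj D C q (.branching p mBl mBr)) (s : State S) :
    ∃ C', CC.Step D C s (.sel p q l) C' s := by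
  induction C generalizing B mBl mBr with
  | interaction eta b C ih =>
    cases hp with
    | pick h => exact ⟨_, .sel rfl⟩
    | com h₁ h₂ h =>
      cases hq with
      | com h₁' h₂' h' =>
        obtain ⟨C', hC'⟩ := ih h h'
        exact ⟨_, .delayEta (by simp [RichLabel.DisjointPs, RichLabel.DisjointP, Eta.pn, *]) hC'⟩
    | sel h₁ h₂ h =>
      cases hq with
      | left => contradiction
      | right => contradiction
      | sel h₁' h₂' h' =>
        obtain ⟨C', hC'⟩ := ih h h'
        exact ⟨_, .delayEta (by simp [RichLabel.DisjointPs, RichLabel.DisjointP, Eta.pn, *]) hC'⟩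
  | cond r b C₁ C₂ ih₁ ih₂ =>
    cases hp with
    | cond' h hp₁ hp₂ hM =>
      cases hq with
      | cond' h' hq₁ hq₂ hM' =>
        cases hM
        -- A branching can only be a merge of branchings from the same process, with possibly fewer
        -- offers.
        have : (∃ m m', Bproj D C₁ q (.branching p m m')) ∧
            ∃ m m', Bproj D C₂ q (.branching p m m') := by
          cases hM' <;> exact ⟨⟨_, _, hq₁⟩, _, _, hq₂⟩
        obtain ⟨⟨_, _, hq₁⟩, _, _, hq₂⟩ := this
        obtain ⟨C₁', hC₁⟩ := ih₁ hp₁ hq₁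
        obtain ⟨C₂', hC₂⟩ := ih₂ hp₂ hq₂
        exact ⟨_, .delayCond ⟨h, h'⟩ hC₁ hC₂⟩
  | call X => cases hp
  | rtCall X ps C ih =>
    cases hp with
    | rtCallOut h hp =>
      cases hq with
      | rtCallOut h' hq =>
        obtain ⟨C', hC'⟩ := ih hp hq
        exact ⟨_, .delayCall (fun r hr => ⟨fun e => h (e ▸ hr), fun e => h' (e ▸ hr)⟩) hC'⟩
  | nil => cases hp

theorem exists_step_cond {C : Choreography S R} {p : S.Pid} {b : S.BExpr}
    {B₁ B₂ : Behaviour S (R × S.Pid)} (hp : Bproj D C p (.cond b B₁ B₂)) (s : State S) :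
    ∃ C', CC.Step D C s (.cond p) C' s := by
  induction C generalizing B₁ B₂ with
  | interaction eta b C ih =>
    cases hp with
    | com h₁ h₂ h | sel h₁ h₂ h =>
      obtain ⟨C', hC'⟩ := ih h
      exact ⟨_, .delayEta (by simp [RichLabel.DisjointPs, RichLabel.DisjointP, Eta.pn, *]) hC'⟩
  | cond r b C₁ C₂ ih₁ ih₂ =>
    cases hp with
    | cond h₁ h₂ =>
      cases hb : S.beval b (s p) with
      | true => exact ⟨_, .condThen hb rfl⟩
      | false => exact ⟨_, .condElse hb rfl⟩
    | cond' h hp₁ hp₂ hM =>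
      cases hM
      obtain ⟨C₁', hC₁⟩ := ih₁ hp₁
      obtain ⟨C₂', hC₂⟩ := ih₂ hp₂
      exact ⟨_, .delayCond h hC₁ hC₂⟩
  | call X => cases hp
  | rtCall X ps C ih =>
    cases hp with
    | rtCallOut h hp =>
      obtain ⟨C', hC'⟩ := ih hp
      exact ⟨_, .delayCall (fun r hr e => h (e ▸ hr)) hC'⟩
  | nil => cases hp

theorem card_toFinset_eq_one_or {α : Type*} [DecidableEq α] {l : List α} {a : α} (h : a ∈ l) :
    l.toFinset.card = 1 ∨ 1 < l.toFinset.card := by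
  have : 0 < l.toFinset.card := Finset.card_pos.2 ⟨a, by simpa using h⟩
  omega

/-- Projecting for `p` produces only calls tagged with `p`. Whether the call is being opened, joined
or completed depends on how many processes are still waiting. -/
theorem exists_step_call {C : Choreography S R} {p p' : S.Pid} {X : R}
    (hp : Bproj D C p (.call (X, p'))) (s : State S) :
    p' = p ∧ ∃ C', CC.Step D C s (.call X p) C' s := by
  induction C with
  | interaction eta b C ih =>
    cases hp with
    | com h₁ h₂ h | sel h₁ h₂ h =>
      obtain ⟨hp, C', hC'⟩ := ih h
      exact ⟨hp, _,
        .delayEta (by simp [RichLabel.DisjointPs, RichLabel.DisjointP, Eta.pn, *]) hC'⟩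
  | cond r b C₁ C₂ ih₁ ih₂ =>
    cases hp with
    | cond' h hp₁ hp₂ hM =>
      cases hM
      obtain ⟨hp, C₁', hC₁⟩ := ih₁ hp₁
      obtain ⟨-, C₂', hC₂⟩ := ih₂ hp₂
      exact ⟨hp, _, .delayCond h hC₁ hC₂⟩
  | call X =>
    cases hp with
    | callIn h =>
      exact ⟨rfl, (card_toFinset_eq_one_or h).elim (fun hc => ⟨_, .callLocal rfl hc h⟩)
        fun hc => ⟨_, .callStart rfl hc h⟩⟩
  | rtCall X ps C ih =>
    cases hp with
    | rtCallIn h =>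
      exact ⟨rfl, (card_toFinset_eq_one_or h).elim (fun hc => ⟨_, .callFinish rfl hc h⟩)
        fun hc => ⟨_, .callEnter rfl hc h⟩⟩
    | rtCallOut h hp =>
      obtain ⟨hp, C', hC'⟩ := ih hp
      exact ⟨hp, _, .delayCall (fun r hr e => h (e ▸ hr)) hC'⟩
  | nil => cases hp

/-! ### Simulation -/

/-- The network `N` offers at least the branches of the projection of the strongly projectable
choreography `C`. -/
structure Refines (D : DefSet S R) (N : Network S (R × S.Pid)) (C : Choreography S R) : Prop where
  strProj : ∀ r, StrProj D C r
  moreBranches : ∀ r, ∃ B, Bproj D C r B ∧ MoreBranches (N r) B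

/-- A network above the projection of a choreography can only do what the choreography can. -/
theorem Refines.exists_step {N N' : Network S (R × S.Pid)} {C : Choreography S R}
    (hN : Refines D N C) {s s' : State S} {t : RichLabel S (R × S.Pid)}
    (h : SP.Step D' N s t N' s') :
    ∃ t' C', t'.forget = t.forget ∧ CC.Step D C s t' C' s' ∧
      ∀ r, LocalStep D' s t' r (N r) (N' r) := by
  cases h with
  | @com p q e x a a' B B' _ v _ _ hp hq hv hs hs' =>
    obtain ⟨_, hBp, hmp⟩ := hN.moreBranches p
    obtain ⟨_, hBq, hmq⟩ := hN.moreBranches q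
    rw [hp] at hmp
    rw [hq] at hmq
    cases hmp
    cases hmq
    subst hv hs hs'
    obtain ⟨C', hC'⟩ := exists_step_com hBp hBq s
    -- One behaviour cannot be both a send and a receive.
    have hpq : p ≠ q := fun h => by subst h; simp [hp] at hq
    refine ⟨_, C', rfl, hC', fun r => ?_⟩
    by_cases hrp : r = p
    · subst hrp; rw [N.set₂_left _ _ hpq, hp]; exact .send
    by_cases hrq : r = q
    · subst hrq; rw [N.set₂_right _ _ hpq, hq]; exact .recv hpq
    rw [N.set₂_of_ne _ _ hrp hrq]
    exact .idle ⟨hrp, hrq⟩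
  | @selLeft p q a a' B Bl mBr _ _ _ hp hq hs hs' =>
    obtain ⟨_, hBp, hmp⟩ := hN.moreBranches p
    obtain ⟨_, hBq, hmq⟩ := hN.moreBranches q
    rw [hp] at hmp
    rw [hq] at hmq
    cases hmp
    subst hs hs'
    have hpq : p ≠ q := fun h => by subst h; simp [hp] at hq
    obtain ⟨C', hC'⟩ : ∃ C', CC.Step D C s (.sel p q .left) C' s := by
      -- The projection may offer fewer labels than `N q`; each case is still a branching from `p`.
      cases hmq <;> exact exists_step_sel hBp hBq s
    refine ⟨_, C', rfl, hC', fun r => ?_⟩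
    by_cases hrp : r = p
    · subst hrp; rw [N.set₂_left _ _ hpq, hp]; exact .sel
    by_cases hrq : r = q
    · subst hrq; rw [N.set₂_right _ _ hpq, hq]; exact .left hpq
    rw [N.set₂_of_ne _ _ hrp hrq]
    exact .idle ⟨hrp, hrq⟩
  | @selRight p q a a' B mBl Br _ _ _ hp hq hs hs' =>
    obtain ⟨_, hBp, hmp⟩ := hN.moreBranches p
    obtain ⟨_, hBq, hmq⟩ := hN.moreBranches q
    rw [hp] at hmp
    rw [hq] at hmq
    cases hmp
    subst hs hs'
    have hpq : p ≠ q := fun h => by subst h; simp [hp] at hq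
    obtain ⟨C', hC'⟩ : ∃ C', CC.Step D C s (.sel p q .right) C' s := by
      cases hmq <;> exact exists_step_sel hBp hBq s
    refine ⟨_, C', rfl, hC', fun r => ?_⟩
    by_cases hrp : r = p
    · subst hrp; rw [N.set₂_left _ _ hpq, hp]; exact .sel
    by_cases hrq : r = q
    · subst hrq; rw [N.set₂_right _ _ hpq, hq]; exact .right hpq
    rw [N.set₂_of_ne _ _ hrp hrq]
    exact .idle ⟨hrp, hrq⟩
  | @condThen p b B₁ B₂ _ _ _ hp hb hs hs' =>
    obtain ⟨_, hBp, hmp⟩ := hN.moreBranches p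
    rw [hp] at hmp
    cases hmp
    subst hs hs'
    obtain ⟨C', hC'⟩ := exists_step_cond hBp s
    refine ⟨_, C', rfl, hC', fun r => ?_⟩
    by_cases hrp : r = p
    · subst hrp; rw [N.set_same, hp]; exact .condThen hb
    rw [N.set_of_ne _ hrp]
    exact .idle hrp
  | @condElse p b B₁ B₂ _ _ _ hp hb hs hs' =>
    obtain ⟨_, hBp, hmp⟩ := hN.moreBranches p
    rw [hp] at hmp
    cases hmp
    subst hs hs'
    obtain ⟨C', hC'⟩ := exists_step_cond hBp s
    refine ⟨_, C', rfl, hC', fun r => ?_⟩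
    by_cases hrp : r = p
    · subst hrp; rw [N.set_same, hp]; exact .condElse hb
    rw [N.set_of_ne _ hrp]
    exact .idle hrp
  | @call p X _ _ _ hp hs hs' =>
    obtain ⟨_, hBp, hmp⟩ := hN.moreBranches p
    rw [hp] at hmp
    cases hmp
    subst hs hs'
    obtain ⟨X, p'⟩ := X
    obtain ⟨rfl, C', hC'⟩ := exists_step_call hBp s
    refine ⟨_, C', rfl, hC', fun r => ?_⟩
    by_cases hrp : r = p'
    · subst hrp; rw [N.set_same, hp]; exact .call
    rw [N.set_of_ne _ hrp]
    exact .idle hrp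

/-- Monotonicity puts `N' r` above the residual of the old projection, which lies above the new
projection. -/
theorem Refines.step (hD : ProjectsTo D D') {N N' : Network S (R × S.Pid)}
    {C C' : Choreography S R} (hN : Refines D N C) {s s' : State S} {t : RichLabel S R}
    (h : CC.Step D C s t C' s') (hl : ∀ r, LocalStep D' s t r (N r) (N' r)) :
    Refines D N' C' where
  strProj := strProj_step hD h hN.strProj
  moreBranches r := by
    obtain ⟨B, hB, hm⟩ := hN.moreBranches r
    obtain ⟨B₀, B', hl', hB', hm'⟩ := bproj_step hD h hN.strProj hB
    exact ⟨B', hB', ((hl r).mono hl' hm).trans hm'⟩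

theorem Refines.exists_stepP (hD : ProjectsTo D D') {N : Network S (R × S.Pid)}
    {C : Choreography S R} (hN : Refines D N C) {s : State S} {tl : TransitionLabel S}
    {c : SP.Configuration S (R × S.Pid)} (h : SP.StepP (⟨D', N⟩, s) tl c) :
    ∃ N' C', c.1 = ⟨D', N'⟩ ∧ CC.StepP (⟨D, C⟩, s) tl (⟨D, C'⟩, c.2) ∧ Refines D N' C' := by
  cases h with
  | base h =>
    obtain ⟨t', C', ht, hC', hl⟩ := hN.exists_step h
    exact ⟨_, C', rfl, ht ▸ .base hC', hN.step hD hC' hl⟩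

theorem Refines.exists_stepStar (hD : ProjectsTo D D') {N : Network S (R × S.Pid)}
    {C : Choreography S R} (hN : Refines D N C) {s : State S} {tls : List (TransitionLabel S)}
    {c : SP.Configuration S (R × S.Pid)} (h : SP.StepStar (⟨D', N⟩, s) tls c) :
    ∃ N' C', c.1 = ⟨D', N'⟩ ∧ CC.StepStar (⟨D, C⟩, s) tls (⟨D, C'⟩, c.2) ∧ Refines D N' C' := by
  -- The network reached is kept as it is, not replaced by a projection; the invariant holds for it,
  -- so the induction continues.
  induction tls generalizing N C s with
  | nil => cases h with | base hs => exact ⟨N, C, rfl, .base hs, hN⟩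
  | cons tl tls ih =>
    cases h with
    | @step _ c' _ _ _ h₁ h₂ =>
      obtain ⟨N₁, C₁, hc, hC, hN₁⟩ := hN.exists_stepP hD h₁
      obtain ⟨P₁, s₁⟩ := c'
      obtain rfl : P₁ = ⟨D', N₁⟩ := hc
      obtain ⟨N₂, C₂, hc₂, hC₂, hN₂⟩ := ih hN₁ h₂
      exact ⟨N₂, C₂, hc₂, .step hC hC₂, hN₂⟩

/-! ### Endpoint projection of programs -/

/-- The default `.nil` outside `P.pn` is a genuine projection, so the network can be treated
uniformly over all processes. -/
theorem bproj_epp_net {P : CC.Program S R} (HP : ProjectableP P) (r : S.Pid) :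
    Bproj P.procedures P.main r ((epp P HP).net r) := by
  by_cases hr : r ∈ P.pn
  · simp only [epp, eppC, dif_pos hr]
    exact (HP.1 r hr).choose_spec
  · simp only [epp, eppC, dif_neg hr]
    exact .of_notMem_pn hr

theorem projectsTo_epp {P : CC.Program S R} (hP : ProgramWF P) (HP : ProjectableP P) :
    ProjectsTo P.procedures (epp P HP).procs where
  initial X := (hP.2.2 X).2.1
  bproj X p := by
    by_cases hp : p ∈ (P.procedures X).1
    · simp only [epp, eppD, dif_pos hp]
      exact (HP.2 X p hp).choose_spec
    · simp only [epp, eppD, dif_neg hp]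
      exact .of_notMem_pn fun h => hp ((hP.2.2 X).2.2.2 h)
  nil X p hp := by simp only [epp, eppD, dif_neg hp]

theorem StrProjP.refines {P : CC.Program S R} (hP : StrProjP P) (HP : ProjectableP P) :
    Refines P.procedures (epp P HP).net P.main :=
  ⟨hP.2.2, fun r => ⟨_, bproj_epp_net HP r, .refl _⟩⟩

theorem Refines.exists_projectableP {N : Network S (R × S.Pid)} {C : Choreography S R}
    (hN : Refines D N C) (H : ProjectableD D) :
    ∃ HP : ProjectableP ⟨D, C⟩, MoreBranchesN N (epp ⟨D, C⟩ HP).net := by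
  have HP : ProjectableP ⟨D, C⟩ := ⟨fun r _ => (hN.strProj r).projectableB, H⟩
  refine ⟨HP, fun r => ?_⟩
  obtain ⟨B, hB, hm⟩ := hN.moreBranches r
  -- Projection is functional, so the behaviour chosen in `epp` is the one supplied by the
  -- invariant.
  rwa [← hB.unique (bproj_epp_net HP r)]

end EPP
end CoreChor

theorem mainTheorem1 {S : CoreChor.Signature.{u}} {R : Type v}
    (P : CoreChor.CC.Program S R) (hP : CoreChor.EPP.StrProjP P)
    (HP : CoreChor.EPP.ProjectableP P) (s s' : CoreChor.State S)
    (N' : CoreChor.SP.Program S (R × S.Pid)) :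
    (∀ tl : CoreChor.TransitionLabel S,
      CoreChor.SP.StepP (CoreChor.EPP.epp P HP, s) tl (N', s') →
        ∃ P' : CoreChor.CC.Program S R, CoreChor.CC.StepP (P, s) tl (P', s') ∧
          ∃ HP' : CoreChor.EPP.ProjectableP P',
            CoreChor.SP.MoreBranchesN N'.net (CoreChor.EPP.epp P' HP').net) ∧
    (∀ tls : List (CoreChor.TransitionLabel S),
      CoreChor.SP.StepStar (CoreChor.EPP.epp P HP, s) tls (N', s') →
        ∃ P' : CoreChor.CC.Program S R, CoreChor.CC.StepStar (P, s) tls (P', s') ∧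
          ∃ HP' : CoreChor.EPP.ProjectableP P',
            CoreChor.SP.MoreBranchesN N'.net (CoreChor.EPP.epp P' HP').net) := by
  have hD := CoreChor.EPP.projectsTo_epp hP.1 HP
  have hN := hP.refines HP
  constructor
  · intro tl h
    obtain ⟨N₁, C', rfl, hC, hN'⟩ := hN.exists_stepP hD h
    exact ⟨_, hC, hN'.exists_projectableP HP.2⟩
  · intro tls h
    obtain ⟨N₁, C', rfl, hC, hN'⟩ := hN.exists_stepStar hD h
    exact ⟨_, hC, hN'.exists_projectableP HP.2⟩
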